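/- Let $q$ be a prime power. Regard the vector space ${\rm GF}(q^2)^3$ underlying ${\rm PG}(2,q^2)$ as a $6$-dimensional vector space over ${\rm GF}(q)$, with projective space ${\rm PG}(5,q)$. The field reduction map $\phi$ sends a point $P$ of ${\rm PG}(2,q^2)$, that is, a one-dimensional ${\rm GF}(q^2)$-subspace, to the line of ${\rm PG}(5,q)$ given by the same subset regarded as a two-dimensional ${\rm GF}(q)$-subspace. The set $\mathcal D=\{\phi(P) : P\in{\rm PG}(2,q^2)\}$ is the Desarguesian line spread: its members are lines, and every point of ${\rm PG}(5,q)$ lies on exactly one of them. A set $\mathcal X$ of points of ${\rm PG}(5,q)$ is a cutting blocking set if, for every hyperplane $\Pi$, the set $\Pi\cap\mathcal X$ spans $\Pi$. A set of lines is in higgledy-piggledy arrangement if the set of points covered by the lines is a cutting blocking set. A Baer subline of ${\rm PG}(2,q^2)$ is a set of points $\{\langle au+bw\rangle : (a,b)\in{\rm GF}(q)^2\setminus\{(0,0)\}\}$ with $u,w$ linearly independent over ${\rm GF}(q^2)$. A degenerate Hermitian curve (of rank $2$) of ${\rm PG}(2,q^2)$ is the union of the lines joining a point $R$ to the points of a Baer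 subline contained in a line not through $R$. For $x\in{\rm GF}(q)\setminus\{0,1\}$ and $\xi\in{\rm GF}(q^2)\setminus{\rm GF}(q)$ let $$\mathcal P_{x,\xi}=\{(1,0,0),(0,1,0),(0,0,1),(1,1,1),(1,x,\xi x),(\xi x,1,x),(x,\xi x,1)\}\subset{\rm PG}(2,q^2),$$ and call $(x,\xi)$ admissible if $\mathcal P_{x,\xi}$ consists of seven points and is contained in no degenerate Hermitian curve. Theorem. The set $\mathcal D$ is a line spread of ${\rm PG}(5,q)$. For every admissible pair $(x,\xi)$, the set $\phi(\mathcal P_{x,\xi})=\{\phi(P) : P\in\mathcal P_{x,\xi}\}$ consists of seven lines of $\mathcal D$ in higgledy-piggledy arrangement; that is, the set of points of ${\rm PG}(5,q)$ on these seven lines is a cutting blocking set. Moreover, if $q\notin\{2,4\}$, then admissible pairs exist. -/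

import Mathlib

open scoped LinearAlgebra.Projectivization

namespace HiggledyPiggledy

section General

variable {K V : Type*} [Field K] [AddCommGroup V] [Module K V]

/-- A hyperplane of a projective space: a maximal proper subspace. -/
def IsHyperplane (H : Projectivization.Subspace K V) : Prop :=
  IsCoatom H

/-- A line of a projective space: a subspace of vector space dimension two. -/
def IsLine (l : Projectivization.Subspace K V) : Prop :=
  Module.finrank K (Projectivization.Subspace.submodule l) = 2

/-- A point set is a cutting blocking set if it meets every hyperplane in a set of points
spanning that hyperplane. -/
def IsCuttingBlockingSet (X : Set (ℙ K V)) : Prop :=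
  ∀ H : Projectivization.Subspace K V, IsHyperplane H →
    Projectivization.Subspace.span ((H : Set (ℙ K V)) ∩ X) = H

/-- The set of points covered by a set of subspaces. -/
def pointsCovered (L : Set (Projectivization.Subspace K V)) : Set (ℙ K V) :=
  {P | ∃ l ∈ L, P ∈ l}

/-- A set of lines in higgledy-piggledy arrangement: the points covered by the lines form a
cutting blocking set. -/
def IsHiggledyPiggledy (L : Set (Projectivization.Subspace K V)) : Prop :=
  (∀ l ∈ L, IsLine l) ∧ IsCuttingBlockingSet (pointsCovered L)

/-- A line spread: a set of lines partitioning the points. -/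
def IsLineSpread (L : Set (Projectivization.Subspace K V)) : Prop :=
  (∀ l ∈ L, IsLine l) ∧ ∀ P : ℙ K V, ∃! l, l ∈ L ∧ P ∈ l

end General

section Plane

variable (F : Type*) {E : Type*} [Field F] [Field E] [Algebra F E]

/-- The field reduction map on points: the one-dimensional `E`-subspace of `E³` underlying a point
of the plane over `E`, regarded as a projective subspace of the `F`-vector space `E³`. -/
def fieldReduction (P : ℙ E (Fin 3 → E)) : Projectivization.Subspace F (Fin 3 → E) :=
  (P.submodule.restrictScalars F).projectivization

/-- The Desarguesian spread: all images of points under field reduction. -/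
def desarguesianSpread (E : Type*) [Field E] [Algebra F E] :
    Set (Projectivization.Subspace F (Fin 3 → E)) :=
  Set.range (fieldReduction F (E := E))

/-- A Baer subline (for `E / F` quadratic): the points of the plane that are represented by the
nonzero `F`-linear combinations of two `E`-linearly independent vectors. -/
def IsBaerSubline (B : Set (ℙ E (Fin 3 → E))) : Prop :=
  ∃ u w : Fin 3 → E, LinearIndependent E ![u, w] ∧
    B = {P | ∃ (v : Fin 3 → E) (hv : v ≠ 0),
      v ∈ Submodule.span F {u, w} ∧ P = Projectivization.mk E v hv}

/-- A degenerate Hermitian curve (of rank two): a cone whose vertex is a point `R` and whose base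
is a Baer subline of a line not passing through `R`. -/
def IsDegenerateHermitianCurve (H : Set (ℙ E (Fin 3 → E))) : Prop :=
  ∃ (R : ℙ E (Fin 3 → E)) (B : Set (ℙ E (Fin 3 → E))), IsBaerSubline F B ∧
    R ∉ Projectivization.Subspace.span B ∧
    H = {Q | ∃ P ∈ B, Q ∈ Projectivization.Subspace.span {R, P}}

variable {F}

/-- The points `(1,0,0)`, `(0,1,0)`, `(0,0,1)`, `(1,1,1)`, `(1,x,ξx)`, `(ξx,1,x)`, `(x,ξx,1)`. -/
def pointSet (x : F) (ξ : E) : Set (ℙ E (Fin 3 → E)) :=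
  {P | ∃ (v : Fin 3 → E) (hv : v ≠ 0), P = Projectivization.mk E v hv ∧
    v ∈ ({![1, 0, 0], ![0, 1, 0], ![0, 0, 1], ![1, 1, 1],
      ![1, algebraMap F E x, ξ * algebraMap F E x],
      ![ξ * algebraMap F E x, 1, algebraMap F E x],
      ![algebraMap F E x, ξ * algebraMap F E x, 1]} : Set (Fin 3 → E))}

/-- The pairs `(x, ξ)` with `x ∈ F \ {0, 1}` and `ξ ∈ E \ F` for which `pointSet x ξ` consists of
seven points and is contained in no degenerate Hermitian curve. -/
def IsAdmissible (x : F) (ξ : E) : Prop :=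
  x ≠ 0 ∧ x ≠ 1 ∧ ξ ∉ Set.range (algebraMap F E) ∧ (pointSet x ξ).ncard = 7 ∧
    ∀ H : Set (ℙ E (Fin 3 → E)), IsDegenerateHermitianCurve F H → ¬ pointSet x ξ ⊆ H

end Plane

end HiggledyPiggledy

/-! Sufficiency (`isCuttingBlockingSet_of_not_subset_curve`). If the covered points of a hyperplane
`ker f` fail to span it, a second functional `g` vanishes on them but not on all of `ker f`. Both
are `ξ`-coordinates of `E`-linear forms `a`, `b`, and at every point of the set the value of `b` is
an `F`-multiple of that of `a`. If `a`, `b` are independent, the set lies on a degenerate Hermitian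
curve; if not, `g` is an `F`-multiple of `f`, because the set lies on no line. Both are impossible.

Existence. Take `ξ ^ 2 = ξ - n`, with conjugate `1 - ξ`, and `x = -y`. A curve through the seven
points gives a skew-Hermitian form `a * τ b - τ a * b` vanishing on them. The three coordinate
points kill its diagonal, leaving entries `A`, `B`, `C`; its determinant is `A * B * C - τ (A * B *
C)`, which is zero. The other four points impose `F`-linear conditions that leave two free
parameters in `F`, and the determinant becomes a binary cubic form in them (`coefficients_eq_zero`).
If this cubic has no zero, then `A = B = C = 0`, and `a`, `b` are dependent (`not_subset_curve`).

It remains to find `n` for which both `t ^ 2 - t + n` and the cubic have no root. The cubic is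
governed by one parameter, a value to be kept out of the range of a rational function invariant
under a map of order three. That range has about `q / 3` elements, against about `q / 2` values of
`n` (`exists_parameters`). -/

namespace HiggledyPiggledy

/-! ### Coordinates in a quadratic extension and the binary cubic -/

section QuadraticExtension

variable {F E : Type*} [Field F] [Field E] [Algebra F E]

/-- An element outside the base field of a quadratic extension generates it additively. -/
theorem exists_eq_add_mul (hFE : Module.finrank F E = 2) {ξ : E}
    (hξ : ξ ∉ Set.range (algebraMap F E)) (z : E) :
    ∃ p r : F, z = algebraMap F E p + algebraMap F E r * ξ := by
  have := Module.finite_of_finrank_pos (hFE ▸ two_pos : 0 < Module.finrank F E)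
  have hli : LinearIndependent F ![(1 : E), ξ] := by
    rw [LinearIndependent.pair_iff' one_ne_zero]
    intro a ha
    exact hξ ⟨a, by rw [← ha, Algebra.smul_def, mul_one]⟩
  have hspan := hli.span_eq_top_of_card_eq_finrank' (by simp [hFE])
  have hz : z ∈ Submodule.span F (Set.range ![(1 : E), ξ]) := by rw [hspan]; trivial
  rw [Matrix.range_cons, Matrix.range_cons, Matrix.range_empty, Set.union_empty,
    Set.singleton_union, Submodule.mem_span_pair] at hz
  obtain ⟨p, r, h⟩ := hz
  exact ⟨p, r, by rw [← h, Algebra.smul_def, Algebra.smul_def, mul_one]⟩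

/-- The coordinates with respect to `1, ξ` are unique. -/
theorem eq_zero_of_add_mul_mem_range {ξ : E} (hξ : ξ ∉ Set.range (algebraMap F E)) {p r c : F}
    (h : algebraMap F E p + algebraMap F E r * ξ = algebraMap F E c) : r = 0 := by
  by_contra hr
  have hr' : algebraMap F E r ≠ 0 := by simpa using hr
  refine hξ ⟨(c - p) / r, ?_⟩
  rw [map_div₀, map_sub, ← h]
  field_simp
  ring

/-- Otherwise `2 * ξ = 1`, which is absurd in characteristic two and puts `ξ` in `F` in any other.
-/
theorem eq_zero_of_fixed {ξ : E} (hξ : ξ ∉ Set.range (algebraMap F E))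
    (τ : E →ₐ[F] E) (hτ : τ ξ = 1 - ξ) {z : E} {p r : F}
    (hz : z = algebraMap F E p + algebraMap F E r * ξ) (h : τ z = z) : r = 0 := by
  by_contra hr
  have hr' : algebraMap F E r ≠ 0 := by simpa using hr
  rw [hz] at h
  simp only [map_add, map_mul, AlgHom.commutes, hτ] at h
  have h1 : 2 * ξ = 1 := by
    apply mul_left_cancel₀ hr'
    linear_combination -h
  have h2 : (2 : E) ≠ 0 := by
    intro h2
    rw [h2, zero_mul] at h1
    exact zero_ne_one h1
  refine hξ ⟨1 / 2, ?_⟩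
  rw [map_div₀, map_one, map_ofNat]
  field_simp
  linear_combination -h1

/-- The coefficients of the cyclic system attached to the seven points vanish as soon as a
certain binary cubic form has no zero. -/
theorem coefficients_eq_zero {ξ : E} (hξ : ξ ∉ Set.range (algebraMap F E))
    (hb : ∀ z : E, ∃ p r : F, z = algebraMap F E p + algebraMap F E r * ξ)
    {n y : F} (hn : ξ ^ 2 = ξ - algebraMap F E n) (τ : E →ₐ[F] E) (hτ : τ ξ = 1 - ξ)
    (hy : y + 1 ≠ 0)
    (hG : ∀ t : F, (2 * y + (1 - n) * (y ^ 2 - y)) * (t ^ 3 + 3 * t ^ 2 - 1) ≠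
      (3 * y + 3 * y ^ 2 - 3 + (1 - n) * (y ^ 3 + 1 - 3 * y)) * (t ^ 2 + t))
    {A B C : E} (hN : τ (A * B * C) = A * B * C) (h0 : τ (A + B + C) = A + B + C)
    (h1 : τ (A - B * algebraMap F E y * (1 - ξ) + C * ξ)
      = A - B * algebraMap F E y * (1 - ξ) + C * ξ)
    (h2 : τ (B - C * algebraMap F E y * (1 - ξ) + A * ξ)
      = B - C * algebraMap F E y * (1 - ξ) + A * ξ)
    (h3 : τ (C - A * algebraMap F E y * (1 - ξ) + B * ξ)
      = C - A * algebraMap F E y * (1 - ξ) + B * ξ) :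
    A = 0 ∧ B = 0 ∧ C = 0 := by
  obtain ⟨a, a', hA⟩ := hb A
  obtain ⟨b, b', hB⟩ := hb B
  obtain ⟨c, c', hC⟩ := hb C
  have im {z : E} (h : τ z = z) (p r : F)
      (hz : z = algebraMap F E p + algebraMap F E r * ξ) : r = 0 :=
    eq_zero_of_fixed hξ τ hτ hz h
  have e0 := im h0 (a + b + c) (a' + b' + c') (by
    simp only [hA, hB, hC, map_add]; ring)
  have lin (a a' b b' c c' : F) :
      (algebraMap F E a + algebraMap F E a' * ξ)
        - (algebraMap F E b + algebraMap F E b' * ξ) * algebraMap F E y * (1 - ξ)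
        + (algebraMap F E c + algebraMap F E c' * ξ) * ξ
      = algebraMap F E (a - b * y - y * b' * n - c' * n)
        + algebraMap F E (a' + y * b + c + c') * ξ := by
    simp only [map_add, map_sub, map_mul]
    linear_combination (algebraMap F E y * algebraMap F E b' + algebraMap F E c') * hn
  have e1 := im h1 _ _ (by rw [hA, hB, hC]; exact lin a a' b b' c c')
  have e2 := im h2 _ _ (by rw [hA, hB, hC]; exact lin b b' c c' a a')
  have e3 := im h3 _ _ (by rw [hA, hB, hC]; exact lin c c' a a' b b')
  -- Here `y + 1 ≠ 0` is the condition `x ≠ 1`. With `s0` everything is expressed through `a` and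
  -- `b`.
  have s0 : a + b + c = 0 := by
    apply mul_left_cancel₀ hy
    linear_combination e1 + e2 + e3 - 2 * e0
  have hc : c = -a - b := by linear_combination s0
  have hb' : b' = y * b + c := by linear_combination e0 - e1
  have hc' : c' = y * c + a := by linear_combination e0 - e2
  have ha' : a' = y * a + b := by linear_combination e0 - e3
  -- The `ξ`-coordinate of `A * B * C`, reduced by `ξ ^ 2 = ξ - n` and `ξ ^ 3 = (1 - n) * ξ - n`.
  have e4 := im hN
    (a * b * c - n * (a' * b' * c + b' * c' * a + c' * a' * b) - n * (a' * b' * c'))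
    ((a' * b * c + b' * c * a + c' * a * b) + (a' * b' * c + b' * c' * a + c' * a' * b)
      + (1 - n) * (a' * b' * c')) (by
    simp only [hA, hB, hC, map_add, map_sub, map_mul, map_one]
    have h3 : ξ ^ 3 = (1 - algebraMap F E n) * ξ - algebraMap F E n := by
      linear_combination (ξ + 1) * hn
    linear_combination (algebraMap F E a' * algebraMap F E b' * algebraMap F E c
        + algebraMap F E b' * algebraMap F E c' * algebraMap F E a
        + algebraMap F E c' * algebraMap F E a' * algebraMap F E b) * hn
      + algebraMap F E a' * algebraMap F E b' * algebraMap F E c' * h3)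
  have e5 : (2 * y + (1 - n) * (y ^ 2 - y)) * (a ^ 3 + 3 * a ^ 2 * b - b ^ 3) =
      (3 * y + 3 * y ^ 2 - 3 + (1 - n) * (y ^ 3 + 1 - 3 * y)) * (a ^ 2 * b + a * b ^ 2) := by
    rw [ha', hb', hc', hc] at e4
    linear_combination e4
  -- The value at `t = 0` is minus the leading coefficient, so `hG 0` also excludes a zero of the
  -- form with `b = 0`.
  have hp := hG 0
  have hb0 : b = 0 := by
    by_contra hb0
    apply hG (a / b)
    field_simp
    linear_combination e5
  have ha0 : a = 0 := by
    rw [hb0] at e5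
    have : (2 * y + (1 - n) * (y ^ 2 - y)) * a ^ 3 = 0 := by linear_combination e5
    rcases mul_eq_zero.1 this with h | h
    · rw [h] at hp
      simp at hp
    · exact pow_eq_zero_iff (three_ne_zero) |>.1 h
  have hc0 : c = 0 := by rw [hc, ha0, hb0]; ring
  subst ha0 hb0 hc0
  simp only [mul_zero, add_zero] at ha' hb' hc'
  subst ha' hb' hc'
  simp [hA, hB, hC]

end QuadraticExtension

/-! ### Degenerate Hermitian curves and pairs of linear forms -/

section Curves

variable {F E : Type*} [Field F] [Field E] [Algebra F E]

theorem mk_mem_span_pair {u w v : Fin 3 → E} (hu : u ≠ 0) (hw : w ≠ 0) (hv : v ≠ 0) :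
    Projectivization.mk E v hv ∈ Projectivization.Subspace.span
      {Projectivization.mk E u hu, Projectivization.mk E w hw} ↔
    v ∈ Submodule.span E {u, w} := by
  constructor
  · intro h
    have hle : Projectivization.Subspace.span
        {Projectivization.mk E u hu, Projectivization.mk E w hw} ≤
        (Submodule.span E {u, w}).projectivization := by
      rw [Projectivization.Subspace.span_le_subspace_iff]
      rintro _ (rfl | rfl)
      · exact Submodule.subset_span (by simp)
      · exact Submodule.subset_span (by simp)
    exact hle h
  · intro h
    rw [← Projectivization.Subspace.mem_submodule_iff _ hv]
    refine Submodule.span_le.2 ?_ h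
    rintro z (rfl | rfl)
    · exact (Projectivization.Subspace.mem_submodule_iff _ hu).2
        (Projectivization.Subspace.subset_span _ (by simp))
    · exact (Projectivization.Subspace.mem_submodule_iff _ hw).2
        (Projectivization.Subspace.subset_span _ (by simp))

/-- A degenerate Hermitian curve lies in the locus where two independent linear forms have
their ratio in the base field. -/
theorem exists_forms_of_curve {H : Set (ℙ E (Fin 3 → E))} (hH : IsDegenerateHermitianCurve F H) :
    ∃ a b : Module.Dual E (Fin 3 → E), LinearIndependent E ![a, b] ∧
      ∀ (v : Fin 3 → E) (hv : v ≠ 0), Projectivization.mk E v hv ∈ H →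
        ∃ (l : E) (α β : F), a v = l * algebraMap F E α ∧ b v = l * algebraMap F E β := by
  obtain ⟨R, B, ⟨u, w, huw, rfl⟩, hR, rfl⟩ := hH
  induction R using Projectivization.ind with | h r hr =>
  have hu : u ≠ 0 := huw.ne_zero 0
  have hw : w ≠ 0 := huw.ne_zero 1
  have hr' : r ∉ Submodule.span E {u, w} := by
    intro h
    apply hR
    refine Projectivization.Subspace.monotone_span ?_ ((mk_mem_span_pair hu hw hr).2 h)
    rintro _ (rfl | rfl)
    · exact ⟨u, hu, Submodule.subset_span (by simp), rfl⟩
    · exact ⟨w, hw, Submodule.subset_span (by simp), rfl⟩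
  have hli : LinearIndependent E ![r, u, w] := by
    refine huw.finCons ?_
    rwa [Matrix.range_cons, Matrix.range_cons, Matrix.range_empty, Set.union_empty,
      Set.singleton_union]
  let bs := basisOfLinearIndependentOfCardEqFinrank hli (by simp)
  have hbs : ⇑bs = ![r, u, w] := coe_basisOfLinearIndependentOfCardEqFinrank hli (by simp)
  have h0 : bs 0 = r := by rw [hbs]; rfl
  have h1 : bs 1 = u := by rw [hbs]; rfl
  have h2 : bs 2 = w := by rw [hbs]; rfl
  have ar : bs.coord 1 r = 0 := by rw [← h0]; simp
  have au : bs.coord 1 u = 1 := by rw [← h1]; simp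
  have aw : bs.coord 1 w = 0 := by rw [← h2]; simp
  have br : bs.coord 2 r = 0 := by rw [← h0]; simp
  have bu : bs.coord 2 u = 0 := by rw [← h1]; simp
  have bw : bs.coord 2 w = 1 := by rw [← h2]; simp
  refine ⟨bs.coord 1, bs.coord 2, ?_, ?_⟩
  · rw [LinearIndependent.pair_iff]
    intro s t hst
    have hs := LinearMap.congr_fun hst u
    have ht := LinearMap.congr_fun hst w
    simp only [LinearMap.add_apply, LinearMap.smul_apply, au, bu, aw, bw, smul_eq_mul, mul_one,
      mul_zero, add_zero, zero_add, LinearMap.zero_apply] at hs ht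
    exact ⟨hs, ht⟩
  · rintro v hv ⟨_, ⟨p, hp, hpm, rfl⟩, hv'⟩
    rw [mk_mem_span_pair hr hp hv, Submodule.mem_span_pair] at hv'
    obtain ⟨ρ, l, rfl⟩ := hv'
    obtain ⟨α, β, rfl⟩ := Submodule.mem_span_pair.1 hpm
    refine ⟨l, α, β, ?_, ?_⟩
    · simp only [map_add, map_smul, ar, algebra_compatible_smul E α, algebra_compatible_smul E β,
        au, aw, smul_eq_mul]
      ring
    · simp only [map_add, map_smul, br, algebra_compatible_smul E α, algebra_compatible_smul E β,
        bu, bw, smul_eq_mul]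
      ring

/-- Two independent linear forms on `E³` can be completed to dual coordinates. -/
theorem exists_dual_vectors {a b : Module.Dual E (Fin 3 → E)} (hab : LinearIndependent E ![a, b]) :
    ∃ u w r : Fin 3 → E, a u = 1 ∧ b u = 0 ∧ a w = 0 ∧ b w = 1 ∧ a r = 0 ∧ b r = 0 ∧ r ≠ 0 ∧
      ∀ v, a v = 0 → b v = 0 → ∃ c : E, v = c • r := by
  have ha : a ≠ 0 := hab.ne_zero 0
  have exu {f : Module.Dual E (Fin 3 → E)} (hf : f ≠ 0) : ∃ v, f v = 1 := by
    obtain ⟨v, hv⟩ : ∃ v, f v ≠ 0 := by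
      by_contra! h
      exact hf (LinearMap.ext h)
    exact ⟨(f v)⁻¹ • v, by simp [hv]⟩
  obtain ⟨u₀, hu₀⟩ := exu ha
  have hb' : b - b u₀ • a ≠ 0 := by
    intro h
    have := LinearIndependent.pair_iff.1 hab (-(b u₀)) 1 (by rw [← h]; module)
    exact one_ne_zero this.2
  obtain ⟨w₀, hw₀⟩ := exu hb'
  simp only [LinearMap.sub_apply, LinearMap.smul_apply, smul_eq_mul] at hw₀
  obtain ⟨w, haw, hbw⟩ : ∃ w, a w = 0 ∧ b w = 1 := by
    refine ⟨w₀ - a w₀ • u₀, ?_, ?_⟩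
    · simp [hu₀]
    · simp only [map_sub, map_smul, smul_eq_mul]
      linear_combination hw₀
  obtain ⟨u, hau, hbu⟩ : ∃ u, a u = 1 ∧ b u = 0 :=
    ⟨u₀ - b u₀ • w, by simp [hu₀, haw], by simp [hbw]⟩
  have hsurj : LinearMap.range (a.prod b) = ⊤ := by
    rw [LinearMap.range_eq_top]
    rintro ⟨s, t⟩
    exact ⟨s • u + t • w, by simp [hau, hbu, haw, hbw]⟩
  have hrank := LinearMap.finrank_range_add_finrank_ker (a.prod b)
  rw [hsurj, finrank_top, Module.finrank_prod, Module.finrank_self, Module.finrank_fin_fun]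
    at hrank
  have hker : Module.finrank E (LinearMap.ker (a.prod b)) = 1 := by omega
  obtain ⟨⟨r, hr⟩, hr0, hall⟩ := finrank_eq_one_iff'.1 hker
  simp only [LinearMap.mem_ker, LinearMap.prod_apply, Function.prod_apply, Prod.mk_eq_zero] at hr
  refine ⟨u, w, r, hau, hbu, haw, hbw, hr.1, hr.2, by simpa using hr0, ?_⟩
  intro v hav hbv
  obtain ⟨c, hc⟩ := hall ⟨v, by simp [hav, hbv]⟩
  exact ⟨c, by simpa using (congrArg Subtype.val hc).symm⟩

/-- Two independent linear forms define a degenerate Hermitian curve. -/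
theorem exists_curve_of_forms {a b : Module.Dual E (Fin 3 → E)}
    (hab : LinearIndependent E ![a, b]) :
    ∃ H : Set (ℙ E (Fin 3 → E)), IsDegenerateHermitianCurve F H ∧
      ∀ (v : Fin 3 → E) (hv : v ≠ 0) (c : F), b v = algebraMap F E c * a v →
        Projectivization.mk E v hv ∈ H := by
  obtain ⟨u, w, r, hau, hbu, haw, hbw, har, hbr, hr, hker⟩ := exists_dual_vectors hab
  have huw : LinearIndependent E ![u, w] := by
    rw [LinearIndependent.pair_iff]
    intro s t hst
    have hs := congrArg a hst
    have ht := congrArg b hst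
    simp only [map_add, map_smul, hau, hbu, haw, hbw, smul_eq_mul, mul_one, mul_zero, add_zero,
      zero_add, map_zero] at hs ht
    exact ⟨hs, ht⟩
  -- The vertex is the common zero of the two forms; the base is the Baer subline spanned by the
  -- dual vectors.
  refine ⟨_, ⟨Projectivization.mk E r hr, _, ⟨u, w, huw, rfl⟩, ?_, rfl⟩, ?_⟩
  · intro hR
    have hle : Projectivization.Subspace.span {P | ∃ (v : Fin 3 → E) (hv : v ≠ 0),
        v ∈ Submodule.span F {u, w} ∧ P = Projectivization.mk E v hv} ≤
        (Submodule.span E {u, w}).projectivization := by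
      rw [Projectivization.Subspace.span_le_subspace_iff]
      rintro _ ⟨v, hv, hvm, rfl⟩
      exact Submodule.span_subset_span F E _ hvm
    have hmem : r ∈ Submodule.span E {u, w} := hle hR
    obtain ⟨s, t, rfl⟩ := Submodule.mem_span_pair.1 hmem
    simp only [map_add, map_smul, hau, hbu, haw, hbw, smul_eq_mul, mul_one, mul_zero, add_zero,
      zero_add] at har hbr
    simp [har, hbr] at hr
  · intro v hv c hc
    have hac : a (c • w) = 0 := by rw [LinearMap.map_smul_of_tower, haw, smul_zero]
    have hbc : b (c • w) = algebraMap F E c := by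
      rw [LinearMap.map_smul_of_tower, hbw, Algebra.smul_def, mul_one]
    have hp : u + c • w ≠ 0 := by
      intro h
      have := congrArg a h
      simp [hau, hac] at this
    refine ⟨Projectivization.mk E _ hp, ⟨_, hp, ?_, rfl⟩, ?_⟩
    · exact Submodule.mem_span_pair.2 ⟨1, c, by simp⟩
    · rw [mk_mem_span_pair hr hp hv, Submodule.mem_span_pair]
      obtain ⟨ρ, hρ⟩ := hker (v - a v • (u + c • w))
        (by simp [hau, hac])
        (by simp [hbu, hbc, hc, mul_comm])
      exact ⟨ρ, a v, by rw [← hρ]; abel⟩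

end Curves

/-! ### Functionals over `F` as coordinates of forms over `E` -/

section Hyperplanes

variable {F E V : Type*} [Field F] [Field E] [Algebra F E] [AddCommGroup V] [Module F V]
  [Module E V]

/-- Every functional over the base field is the `ξ`-coordinate of a functional over the quadratic
extension. -/
theorem exists_linear_form [IsScalarTower F E V] (hFE : Module.finrank F E = 2) {ξ : E}
    (hξ : ξ ∉ Set.range (algebraMap F E)) :
    ∃ s : F, ∀ f : Module.Dual F V, ∃ a : Module.Dual E V, ∀ v,
      a v = algebraMap F E (f (ξ • v) - s * f v) + algebraMap F E (f v) * ξ := by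
  obtain ⟨m, s, hs⟩ := exists_eq_add_mul hFE hξ (ξ ^ 2)
  refine ⟨s, fun f => ?_⟩
  have hF (c : F) (v : V) : algebraMap F E c • v = c • v := algebraMap_smul E c v
  -- With `ξ ^ 2 = m + s * ξ`, comparing `ξ`-coordinates in `a (ξ • v) = ξ * a v` forces the
  -- constant coordinate.
  refine ⟨
    { toFun := fun v => algebraMap F E (f (ξ • v) - s * f v) + algebraMap F E (f v) * ξ
      map_add' := ?_
      map_smul' := ?_ }, fun v => rfl⟩
  · intro v w
    simp only [smul_add, map_add, map_sub, map_mul]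
    ring
  · intro e v
    obtain ⟨p, r, rfl⟩ := exists_eq_add_mul hFE hξ e
    have h1 : f ((algebraMap F E p + algebraMap F E r * ξ) • v) = p * f v + r * f (ξ • v) := by
      rw [add_smul, mul_smul, hF, hF, map_add, map_smul, map_smul, smul_eq_mul, smul_eq_mul]
    have h2 : f (ξ • (algebraMap F E p + algebraMap F E r * ξ) • v)
        = p * f (ξ • v) + r * (m * f v + s * f (ξ • v)) := by
      have : ξ • (algebraMap F E p + algebraMap F E r * ξ) • v
          = p • ξ • v + r • (m • v + s • ξ • v) := by
        rw [← hF p, ← hF r, ← hF m, ← hF s, smul_smul, smul_smul, smul_smul, ← add_smul,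
          smul_smul, ← add_smul]
        congr 1
        linear_combination algebraMap F E r * hs
      rw [this]
      simp only [map_add, map_smul, smul_eq_mul]
    rw [h1, h2]
    simp only [map_add, map_sub, map_mul, smul_eq_mul, RingHom.id_apply]
    linear_combination (-(algebraMap F E r) * algebraMap F E (f v)) * hs

/-- If a functional vanishes on every scalar multiple of `v` killed by another one, then the
associated forms over the quadratic extension have proportional values at `v`. -/
theorem exists_ratio {ξ : E}
    (hξ : ξ ∉ Set.range (algebraMap F E)) {s : F} {f g : Module.Dual F V} {a b : Module.Dual E V}
    (ha : ∀ v, a v = algebraMap F E (f (ξ • v) - s * f v) + algebraMap F E (f v) * ξ)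
    (hb : ∀ v, b v = algebraMap F E (g (ξ • v) - s * g v) + algebraMap F E (g v) * ξ)
    {v : V} (h : ∀ e : E, f (e • v) = 0 → g (e • v) = 0) :
    ∃ c : F, b v = algebraMap F E c * a v := by
  by_cases hav : a v = 0
  · have hf (e : E) : f (e • v) = 0 := by
      have h0 : a (e • v) = 0 := by rw [map_smul, hav, smul_zero]
      rw [ha] at h0
      exact eq_zero_of_add_mul_mem_range hξ (c := 0) (by rw [h0, map_zero])
    refine ⟨0, ?_⟩
    have h1 := h _ (hf 1)
    rw [one_smul] at h1
    rw [hb, h _ (hf ξ), h1]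
    simp
  -- Scaled so that `a` takes the value `1`, the vector is killed by `f`, hence by `g`; so `b` takes
  -- a value in `F` there.
  · have h1 : a ((a v)⁻¹ • v) = 1 := by rw [map_smul, smul_eq_mul, inv_mul_cancel₀ hav]
    have hf : f ((a v)⁻¹ • v) = 0 := by
      rw [ha] at h1
      exact eq_zero_of_add_mul_mem_range hξ (c := 1) (by rw [h1, map_one])
    have hg := h _ hf
    have h2 := hb ((a v)⁻¹ • v)
    rw [hg, map_zero, zero_mul, add_zero, map_smul, smul_eq_mul] at h2
    exact ⟨g (ξ • (a v)⁻¹ • v) - s * 0, by rw [← h2]; field_simp⟩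

end Hyperplanes

/-! ### The Desarguesian spread and the cutting criterion -/

section Plane

variable {F E : Type*} [Field F] [Field E] [Algebra F E]

theorem mem_fieldReduction {v w : Fin 3 → E} (hv : v ≠ 0) (hw : w ≠ 0) :
    Projectivization.mk F w hw ∈ fieldReduction F (Projectivization.mk E v hv) ↔
      ∃ e : E, e • v = w := by
  rw [fieldReduction, Submodule.mk_mem_projectivization_iff, Submodule.restrictScalars_mem,
    Projectivization.submodule_mk, Submodule.mem_span_singleton]

theorem fieldReduction_injective :
    Function.Injective (fieldReduction F (E := E)) := by
  intro P Q h
  apply Projectivization.submodule_injective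
  exact Submodule.restrictScalars_injective F E _
    ((Submodule.projectivization (K := F) (V := Fin 3 → E)).injective h)

theorem isLine_fieldReduction (hFE : Module.finrank F E = 2) (P : ℙ E (Fin 3 → E)) :
    IsLine (fieldReduction F P) := by
  rw [IsLine, fieldReduction, OrderIso.apply_symm_apply]
  change Module.finrank F P.submodule = 2
  rw [← Module.finrank_mul_finrank F E P.submodule, hFE, Projectivization.finrank_submodule]

theorem isLineSpread_desarguesianSpread (hFE : Module.finrank F E = 2) :
    IsLineSpread (desarguesianSpread F E) := by
  refine ⟨?_, ?_⟩
  · rintro _ ⟨P, rfl⟩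
    exact isLine_fieldReduction hFE P
  · intro P
    induction P using Projectivization.ind with | h w hw =>
    refine ⟨fieldReduction F (Projectivization.mk E w hw),
      ⟨⟨_, rfl⟩, (mem_fieldReduction hw hw).2 ⟨1, one_smul _ _⟩⟩, ?_⟩
    rintro _ ⟨⟨Q, rfl⟩, hQ⟩
    induction Q using Projectivization.ind with | h v hv =>
    obtain ⟨e, he⟩ := (mem_fieldReduction hv hw).1 hQ
    congr 1
    exact ((Projectivization.mk_eq_mk_iff' E w v hw hv).2 ⟨e, he⟩).symm

/-- A set of points of the plane that lies on no line and is contained in no degenerate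
Hermitian curve is mapped by field reduction to lines covering a cutting blocking set. -/
theorem isCuttingBlockingSet_of_not_subset_curve (hFE : Module.finrank F E = 2) {ξ : E}
    (hξ : ξ ∉ Set.range (algebraMap F E)) {S : Set (ℙ E (Fin 3 → E))}
    (hS : ∀ a : Module.Dual E (Fin 3 → E), a ≠ 0 →
      ∃ (v : Fin 3 → E) (hv : v ≠ 0), Projectivization.mk E v hv ∈ S ∧ a v ≠ 0)
    (hH : ∀ H : Set (ℙ E (Fin 3 → E)), IsDegenerateHermitianCurve F H → ¬ S ⊆ H) :
    IsCuttingBlockingSet (pointsCovered (fieldReduction F '' S)) := by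
  intro L hL
  refine le_antisymm
    (Projectivization.Subspace.span_le_subspace_iff.2 Set.inter_subset_left) ?_
  set W := Projectivization.Subspace.span
    ((L : Set (ℙ F (Fin 3 → E))) ∩ pointsCovered (fieldReduction F '' S)) with hW
  have hco : IsCoatom (Projectivization.Subspace.submodule L) :=
    (OrderIso.isCoatom_iff Projectivization.Subspace.submodule L).2 hL
  obtain ⟨f, hf0, hf⟩ := Submodule.exists_le_ker_of_lt_top _ hco.lt_top
  have hker : LinearMap.ker f = Projectivization.Subspace.submodule L :=
    (hco.le_iff.1 hf).resolve_left fun h => hf0 (LinearMap.ker_eq_top.1 h)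
  rw [← Projectivization.Subspace.submodule.le_iff_le]
  intro h hh
  by_contra hhW
  obtain ⟨g, hgh, hg⟩ := Submodule.exists_le_ker_of_notMem hhW
  obtain ⟨s, hforms⟩ := exists_linear_form (V := Fin 3 → E) hFE hξ
  obtain ⟨a, ha⟩ := hforms f
  obtain ⟨b, hb⟩ := hforms g
  have ha0 : a ≠ 0 := by
    rintro rfl
    refine hf0 (LinearMap.ext fun v => ?_)
    exact eq_zero_of_add_mul_mem_range hξ (c := 0) (by rw [← ha v]; simp)
  have key (v : Fin 3 → E) (hv : v ≠ 0) (hvS : Projectivization.mk E v hv ∈ S) :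
      ∃ c : F, b v = algebraMap F E c * a v := by
    refine exists_ratio hξ ha hb fun e he => ?_
    by_cases hev : e • v = 0
    · rw [hev, map_zero]
    · refine hg ((Projectivization.Subspace.mem_submodule_iff _ hev).2
        (Projectivization.Subspace.subset_span _ ⟨?_, ?_⟩))
      · have : e • v ∈ Projectivization.Subspace.submodule L := by rw [← hker]; exact he
        exact (Projectivization.Subspace.mem_submodule_iff _ hev).1 this
      · exact ⟨_, ⟨_, hvS, rfl⟩, (mem_fieldReduction hv hev).2 ⟨e, rfl⟩⟩
  by_cases hab : LinearIndependent E ![a, b]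
  · obtain ⟨H, hHc, hHm⟩ := exists_curve_of_forms (F := F) hab
    refine hH H hHc fun P hP => ?_
    induction P using Projectivization.ind with | h v hv =>
    obtain ⟨c, hc⟩ := key v hv hP
    exact hHm v hv c hc
  -- Now `b = e • a`, and a point of `S` off the line `a = 0` shows `e` to lie in `F`. Since `f h =
  -- 0`, both `a h` and `b h` lie in `F`, so `g h = 0`.
  · rw [LinearIndependent.pair_iff' ha0] at hab
    push Not at hab
    obtain ⟨e, rfl⟩ := hab
    obtain ⟨v, hv, hvS, hav⟩ := hS a ha0
    obtain ⟨c, hc⟩ := key v hv hvS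
    rw [LinearMap.smul_apply, smul_eq_mul] at hc
    obtain rfl := mul_right_cancel₀ hav hc
    apply hgh
    have hfh : f h = 0 := hf hh
    have h1 := hb h
    rw [LinearMap.smul_apply, smul_eq_mul, ha, hfh] at h1
    refine eq_zero_of_add_mul_mem_range hξ (c := c * f (ξ • h)) (h1.symm.trans ?_)
    simp

theorem pointSet_frame (x : F) (ξ : E) (a : Module.Dual E (Fin 3 → E)) (ha : a ≠ 0) :
    ∃ (v : Fin 3 → E) (hv : v ≠ 0), Projectivization.mk E v hv ∈ pointSet x ξ ∧ a v ≠ 0 := by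
  by_contra! h
  apply ha
  have h0 : a ![1, 0, 0] = 0 := h _ (by simp) ⟨_, by simp, rfl, by simp⟩
  have h1 : a ![0, 1, 0] = 0 := h _ (by simp) ⟨_, by simp, rfl, by simp⟩
  have h2 : a ![0, 0, 1] = 0 := h _ (by simp) ⟨_, by simp, rfl, by simp⟩
  refine (Pi.basisFun E (Fin 3)).ext fun i => ?_
  rw [Pi.basisFun_apply, LinearMap.zero_apply]
  have e0 : (Pi.single 0 1 : Fin 3 → E) = ![1, 0, 0] := by ext j; fin_cases j <;> simp
  have e1 : (Pi.single 1 1 : Fin 3 → E) = ![0, 1, 0] := by ext j; fin_cases j <;> simp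
  have e2 : (Pi.single 2 1 : Fin 3 → E) = ![0, 0, 1] := by ext j; fin_cases j <;> simp
  fin_cases i
  · exact (congrArg a e0).trans h0
  · exact (congrArg a e1).trans h1
  · exact (congrArg a e2).trans h2

end Plane

/-! ### The seven points and the Hermitian form through them -/

section SevenPoints

variable {F E : Type*} [Field F] [Field E] [Algebra F E]

/-- The seven representatives of `pointSet x ξ`. -/
def representatives (x : F) (ξ : E) : Fin 7 → Fin 3 → E :=
  ![![1, 0, 0], ![0, 1, 0], ![0, 0, 1], ![1, 1, 1],
    ![1, algebraMap F E x, ξ * algebraMap F E x],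
    ![ξ * algebraMap F E x, 1, algebraMap F E x],
    ![algebraMap F E x, ξ * algebraMap F E x, 1]]

theorem representatives_ne_zero (x : F) (ξ : E) (i : Fin 7) : representatives x ξ i ≠ 0 := by
  fin_cases i <;> simp [representatives]

theorem pointSet_eq_range (x : F) (ξ : E) :
    pointSet x ξ = Set.range fun i =>
      Projectivization.mk E (representatives x ξ i) (representatives_ne_zero x ξ i) := by
  have hr : ({![1, 0, 0], ![0, 1, 0], ![0, 0, 1], ![1, 1, 1],
      ![1, algebraMap F E x, ξ * algebraMap F E x],
      ![ξ * algebraMap F E x, 1, algebraMap F E x],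
      ![algebraMap F E x, ξ * algebraMap F E x, 1]} : Set (Fin 3 → E))
      = Set.range (representatives x ξ) := by
    ext v
    simp only [representatives, Matrix.range_cons, Matrix.range_empty, Set.mem_insert_iff,
      Set.mem_singleton_iff, Set.mem_union, Set.mem_empty_iff_false, or_false]
  ext P
  rw [pointSet, hr]
  constructor
  · rintro ⟨v, hv, rfl, i, rfl⟩
    exact ⟨i, rfl⟩
  · rintro ⟨i, rfl⟩
    exact ⟨_, representatives_ne_zero x ξ i, rfl, i, rfl⟩

theorem ncard_pointSet {x : F} {ξ : E} (hx0 : x ≠ 0) (hx1 : x ≠ 1)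
    (hξ : ξ ∉ Set.range (algebraMap F E)) : (pointSet x ξ).ncard = 7 := by
  have hinj : Function.Injective fun i =>
      Projectivization.mk E (representatives x ξ i) (representatives_ne_zero x ξ i) := by
    intro i j hij
    obtain ⟨c, hc⟩ := (Projectivization.mk_eq_mk_iff' E _ _ _ _).1 hij
    have c0 := congrFun hc 0
    have c1 := congrFun hc 1
    have c2 := congrFun hc 2
    have h0 : algebraMap F E x ≠ 0 := by simpa using hx0
    have h1 : algebraMap F E x ≠ 1 := by simpa using hx1
    have h2 : ξ ≠ algebraMap F E x := fun h => hξ ⟨x, h.symm⟩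
    have h3 : ξ * algebraMap F E x * algebraMap F E x ≠ 1 := by
      intro h
      refine hξ ⟨(x * x)⁻¹, ?_⟩
      rw [map_inv₀, map_mul]
      field_simp
      linear_combination -h
    clear hij hc hξ
    fin_cases i <;> fin_cases j <;> first
      | rfl
      | (exfalso
         simp [representatives] at c0 c1 c2 <;> grind)
  rw [pointSet_eq_range, ← Set.image_univ, Set.ncard_image_of_injective _ hinj, Set.ncard_univ]
  simp

theorem dual_apply (a : Module.Dual E (Fin 3 → E)) (v : Fin 3 → E) :
    a v = v 0 * a ![1, 0, 0] + v 1 * a ![0, 1, 0] + v 2 * a ![0, 0, 1] := by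
  have hv : v = v 0 • ![1, 0, 0] + v 1 • ![0, 1, 0] + v 2 • ![0, 0, 1] := by
    ext i
    fin_cases i <;> simp
  conv_lhs => rw [hv]
  simp only [map_add, map_smul, smul_eq_mul]

theorem exists_conjugation [Finite F] (hFE : Module.finrank F E = 2) {ξ : E}
    (hξ : ξ ∉ Set.range (algebraMap F E)) {n : F} (hn : ξ ^ 2 = ξ - algebraMap F E n) :
    ∃ τ : E →ₐ[F] E, τ ξ = 1 - ξ := by
  have := Module.finite_of_finrank_pos (hFE ▸ two_pos : 0 < Module.finrank F E)
  have : Finite E := Module.finite_of_finite F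
  obtain ⟨σ, hσ⟩ : ∃ σ : E ≃ₐ[F] E, σ ξ ≠ ξ := by
    by_contra! h
    exact hξ ((IsGalois.mem_range_algebraMap_iff_fixed ξ).2 h)
  refine ⟨σ.toAlgHom, ?_⟩
  have h := congrArg σ hn
  simp only [map_pow, map_sub, AlgEquiv.commutes] at h
  have : (σ ξ - ξ) * (σ ξ - (1 - ξ)) = 0 := by linear_combination h - hn
  exact sub_eq_zero.1 ((mul_eq_zero.1 this).resolve_left (sub_ne_zero.2 hσ))

theorem not_subset_curve [Finite F] (hFE : Module.finrank F E = 2) {ξ : E}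
    (hξ : ξ ∉ Set.range (algebraMap F E)) {n : F} (hn : ξ ^ 2 = ξ - algebraMap F E n)
    {y : F} (hy0 : y ≠ 0) (hy1 : y + 1 ≠ 0)
    (hG : ∀ t : F, (2 * y + (1 - n) * (y ^ 2 - y)) * (t ^ 3 + 3 * t ^ 2 - 1) ≠
      (3 * y + 3 * y ^ 2 - 3 + (1 - n) * (y ^ 3 + 1 - 3 * y)) * (t ^ 2 + t))
    {H : Set (ℙ E (Fin 3 → E))} (hH : IsDegenerateHermitianCurve F H) :
    ¬ pointSet (-y) ξ ⊆ H := by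
  intro hsub
  obtain ⟨τ, hτ⟩ := exists_conjugation hFE hξ hn
  have hbas := exists_eq_add_mul hFE hξ
  have hττ (z : E) : τ (τ z) = z := by
    obtain ⟨p, r, rfl⟩ := hbas z
    simp [hτ]
  have hyE : algebraMap F E y ≠ 0 := by simpa using hy0
  obtain ⟨a, b, hab, hform⟩ := exists_forms_of_curve hH
  have hrep (i : Fin 7) := hform _ (representatives_ne_zero (-y) ξ i)
    (hsub (by rw [pointSet_eq_range]; exact ⟨i, rfl⟩))
  obtain ⟨l₁, α₁, β₁, ha₁, hb₁⟩ : ∃ (l : E) (α β : F), a ![1, 0, 0] = l * algebraMap F E α ∧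
    b ![1, 0, 0] = l * algebraMap F E β := hrep 0
  obtain ⟨l₂, α₂, β₂, ha₂, hb₂⟩ : ∃ (l : E) (α β : F), a ![0, 1, 0] = l * algebraMap F E α ∧
    b ![0, 1, 0] = l * algebraMap F E β := hrep 1
  obtain ⟨l₃, α₃, β₃, ha₃, hb₃⟩ : ∃ (l : E) (α β : F), a ![0, 0, 1] = l * algebraMap F E α ∧
    b ![0, 0, 1] = l * algebraMap F E β := hrep 2
  -- On the curve `a` and `b` have their ratio in `F`, so `a * τ b` is fixed by `τ`.
  have skew (i : Fin 7) : a (representatives (-y) ξ i) * τ (b (representatives (-y) ξ i))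
      = τ (a (representatives (-y) ξ i)) * b (representatives (-y) ξ i) := by
    obtain ⟨l, α, β, h1, h2⟩ := hrep i
    rw [h1, h2]
    simp only [map_mul, AlgHom.commutes]
    ring
  have expand (p q r p' q' r' : E) (hp : τ p = p') (hq : τ q = q') (hr : τ r = r')
      (h : a ![p, q, r] * τ (b ![p, q, r]) = τ (a ![p, q, r]) * b ![p, q, r]) :
      (p * q' * (l₁ * τ l₂) - p' * q * (τ l₁ * l₂)) *
          algebraMap F E (α₁ * β₂ - α₂ * β₁)
        + (q * r' * (l₂ * τ l₃) - q' * r * (τ l₂ * l₃)) *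
          algebraMap F E (α₂ * β₃ - α₃ * β₂)
        + (r * p' * (l₃ * τ l₁) - r' * p * (τ l₃ * l₁)) *
          algebraMap F E (α₃ * β₁ - α₁ * β₃) = 0 := by
    rw [dual_apply a, dual_apply b, ha₁, ha₂, ha₃, hb₁, hb₂, hb₃] at h
    simp only [Matrix.cons_val, map_add, map_mul, AlgHom.commutes, hp, hq, hr] at h
    simp only [map_sub, map_mul]
    linear_combination h
  have τy : τ (algebraMap F E (-y)) = algebraMap F E (-y) := AlgHom.commutes _ _
  have τξy : τ (ξ * algebraMap F E (-y)) = (1 - ξ) * algebraMap F E (-y) := by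
    rw [map_mul, τy, hτ]
  have w0 := expand 1 1 1 1 1 1 (map_one τ) (map_one τ) (map_one τ) (skew 3)
  have w1 := expand _ _ _ _ _ _ (map_one τ) τy τξy (skew 4)
  have w2 := expand _ _ _ _ _ _ τξy (map_one τ) τy (skew 5)
  have w3 := expand _ _ _ _ _ _ τy τξy (map_one τ) (skew 6)
  obtain ⟨hA, hB, hC⟩ := coefficients_eq_zero hξ hbas hn τ hτ hy1 hG
    (A := l₁ * τ l₂ * algebraMap F E (α₁ * β₂ - α₂ * β₁))
    (B := l₂ * τ l₃ * algebraMap F E (α₂ * β₃ - α₃ * β₂))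
    (C := l₃ * τ l₁ * algebraMap F E (α₃ * β₁ - α₁ * β₃))
    -- The product is that of the three norms `lᵢ * τ lᵢ` and an element of `F`.
    (by simp only [map_mul, hττ, AlgHom.commutes]; ring)
    (by
      simp only [map_mul, map_add, hττ, AlgHom.commutes]
      linear_combination -w0)
    (by
      simp only [map_mul, map_add, map_sub, map_one, hττ, AlgHom.commutes, hτ]
      apply mul_left_cancel₀ hyE
      simp only [map_neg, map_sub, map_mul] at w1 ⊢
      linear_combination w1)
    (by
      simp only [map_mul, map_add, map_sub, map_one, hττ, AlgHom.commutes, hτ]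
      apply mul_left_cancel₀ hyE
      simp only [map_neg, map_sub, map_mul] at w2 ⊢
      linear_combination w2)
    (by
      simp only [map_mul, map_add, map_sub, map_one, hττ, AlgHom.commutes, hτ]
      apply mul_left_cancel₀ hyE
      simp only [map_neg, map_sub, map_mul] at w3 ⊢
      linear_combination w3)
  have drop {l m c : E} (h : l * τ m * c = 0) : l * m * c = 0 := by
    rcases mul_eq_zero.1 h with h | h
    · rcases mul_eq_zero.1 h with h | h
      · rw [h]; ring
      · rw [(map_eq_zero τ).1 h]; ring
    · rw [h]; ring
  have dA := drop hA
  have dB := drop hB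
  have dC := drop hC
  simp only [map_sub, map_mul] at dA dB dC
  obtain ⟨u, w, -, hau, -, haw, hbw, -⟩ := exists_dual_vectors hab
  -- All `2 × 2` minors of the coefficients of `a` and `b` vanish, whereas on the dual vectors the
  -- determinant is `1`.
  have hzero : a u * b w - a w * b u = 0 := by
    rw [dual_apply a u, dual_apply a w, dual_apply b u, dual_apply b w,
      ha₁, ha₂, ha₃, hb₁, hb₂, hb₃]
    linear_combination (u 0 * w 1 - u 1 * w 0) * dA + (u 1 * w 2 - u 2 * w 1) * dB
      + (u 2 * w 0 - u 0 * w 2) * dC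
  simp [hau, haw, hbw] at hzero

theorem isAdmissible_neg [Finite F] (hFE : Module.finrank F E = 2) {ξ : E}
    (hξ : ξ ∉ Set.range (algebraMap F E)) {n : F} (hn : ξ ^ 2 = ξ - algebraMap F E n)
    {y : F} (hy0 : y ≠ 0) (hy1 : y + 1 ≠ 0)
    (hG : ∀ t : F, (2 * y + (1 - n) * (y ^ 2 - y)) * (t ^ 3 + 3 * t ^ 2 - 1) ≠
      (3 * y + 3 * y ^ 2 - 3 + (1 - n) * (y ^ 3 + 1 - 3 * y)) * (t ^ 2 + t)) :
    IsAdmissible (-y) ξ := by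
  have h0 : -y ≠ 0 := neg_ne_zero.2 hy0
  have h1 : -y ≠ 1 := fun h => hy1 (by rw [← h]; ring)
  exact ⟨h0, h1, hξ, ncard_pointSet h0 h1 hξ, fun H hH => not_subset_curve hFE hξ hn hy0 hy1 hG hH⟩

end SevenPoints

/-! ### Counting parameters for which neither polynomial has a root -/

section Counting

open Finset

/-- Here `t` plays the set of exceptional points (fixed points of a symmetry of `f`): it contributes
at most `#t` values, and the other fibres have at least `k` elements. -/
theorem mul_card_image_add_card_le {α β : Type*} [DecidableEq α] [DecidableEq β] {s t : Finset α}
    (hts : t ⊆ s) (f : α → β) (k : ℕ)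
    (h : ∀ a ∈ s \ t, k ≤ #{x ∈ s \ t | f x = f a}) :
    k * #(s.image f) + #t ≤ #s + k * #t := by
  have h1 : k * #((s \ t).image f) ≤ #(s \ t) := by
    refine mul_card_image_le_card _ _ fun b hb => ?_
    obtain ⟨a, ha, rfl⟩ := mem_image.1 hb
    exact h a ha
  have h2 : #(s.image f) ≤ #(t.image f) + #((s \ t).image f) := by
    rw [← union_sdiff_of_subset hts, image_union, union_sdiff_of_subset hts]
    exact card_union_le _ _
  have h3 : #(t.image f) ≤ #t := card_image_le
  have h4 := card_sdiff_add_card_eq_card hts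
  have h5 := Nat.mul_le_mul_left k (h2.trans (Nat.add_le_add_right h3 _))
  rw [Nat.mul_add] at h5
  omega

variable {F : Type*} [Field F] [Fintype F] [DecidableEq F]

/-- The map is invariant under `t ↦ 1 - t`, which has at most one fixed point. -/
theorem two_mul_card_image_sub_sq_le :
    2 * #(univ.image fun t : F => t - t ^ 2) ≤ Fintype.card F + 1 := by
  have h := mul_card_image_add_card_le (subset_univ {t : F | t = 1 - t})
    (fun t : F => t - t ^ 2) 2 (by
    intro a ha
    have hne : a ≠ 1 - a := by simpa using ha
    refine (card_pair hne).symm.le.trans (card_le_card fun x hx => ?_)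
    simp only [mem_insert, mem_singleton] at hx
    simp only [mem_filter, mem_sdiff, mem_univ, true_and]
    rcases hx with rfl | rfl
    · exact ⟨hne, rfl⟩
    · exact ⟨fun h => hne (by linear_combination -h), by ring⟩)
  have h1 : #{t : F | t = 1 - t} ≤ 1 := by
    rw [card_le_one]
    intro a ha b hb
    simp only [mem_filter, mem_univ, true_and] at ha hb
    have h2 : (2 : F) ≠ 0 := by
      intro h2
      have : (1 : F) = 0 := by linear_combination a * h2 - ha
      exact one_ne_zero this
    apply mul_left_cancel₀ h2
    linear_combination ha - hb
  rw [card_univ] at h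
  omega

theorem card_roots_le_two : #{t : F | t ^ 2 + t + 1 = 0} ≤ 2 := by
  rcases ({t : F | t ^ 2 + t + 1 = 0} : Finset F).eq_empty_or_nonempty with h | ⟨a, ha⟩
  · simp [h]
  · refine (card_le_card (t := {a, -1 - a}) fun b hb => ?_).trans card_le_two
    simp only [mem_filter, mem_univ, true_and] at ha hb
    have : (b - a) * (b - (-1 - a)) = 0 := by linear_combination hb - ha
    simpa [sub_eq_zero] using this

/-- The parameters `c` for which the cubic `t³ + 3t² - 1 - c (t² + t)` has a root. -/
def rootParameters (F : Type*) [Field F] [Fintype F] [DecidableEq F] : Finset F :=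
  ({t : F | t ≠ 0 ∧ t + 1 ≠ 0} : Finset F).image
    fun t => (t ^ 3 + 3 * t ^ 2 - 1) / (t ^ 2 + t)

/-- The rational function is invariant under `t ↦ -1 / (t + 1)`, of order three, whose fixed points
are the roots of `t ^ 2 + t + 1`. -/
theorem three_mul_card_rootParameters_le :
    3 * #(rootParameters F) + 2 ≤ Fintype.card F + 2 * #{t : F | t ^ 2 + t + 1 = 0} := by
  have hts : ({t : F | t ^ 2 + t + 1 = 0} : Finset F) ⊆
      ({t : F | t ≠ 0 ∧ t + 1 ≠ 0} : Finset F) := by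
    intro t ht
    simp only [mem_filter, mem_univ, true_and] at ht ⊢
    refine ⟨?_, fun h => ?_⟩
    · rintro rfl
      simp at ht
    · have : (1 : F) = 0 := by linear_combination ht - t * h
      exact one_ne_zero this
  have h := mul_card_image_add_card_le hts
    (fun t : F => (t ^ 3 + 3 * t ^ 2 - 1) / (t ^ 2 + t)) 3 (by
    intro a ha
    simp only [mem_filter, mem_sdiff, mem_univ, true_and] at ha
    obtain ⟨⟨h0, h1⟩, h2⟩ := ha
    have ha2 : a ^ 2 + a ≠ 0 := by
      have : a ^ 2 + a = a * (a + 1) := by ring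
      rw [this]
      exact mul_ne_zero h0 h1
    have hθ : -1 / (a + 1) + 1 = a / (a + 1) := by field_simp; ring
    have hθθ : -(a + 1) / a + 1 = -1 / a := by field_simp; ring
    have n1 : a ≠ -1 / (a + 1) := by
      intro h
      rw [eq_div_iff h1] at h
      exact h2 (by linear_combination h)
    have n2 : a ≠ -(a + 1) / a := by
      intro h
      rw [eq_div_iff h0] at h
      exact h2 (by linear_combination h)
    have n3 : -1 / (a + 1) ≠ -(a + 1) / a := by
      intro h
      rw [div_eq_div_iff h1 h0] at h
      exact h2 (by linear_combination h)
    have hcard : #{a, -1 / (a + 1), -(a + 1) / a} = 3 := card_eq_three.2 ⟨_, _, _, n1, n2, n3, rfl⟩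
    refine hcard.symm.le.trans (card_le_card fun x hx => ?_)
    simp only [mem_insert, mem_singleton] at hx
    simp only [mem_filter, mem_sdiff, mem_univ, true_and]
    rcases hx with rfl | rfl | rfl
    · exact ⟨⟨⟨h0, h1⟩, h2⟩, rfl⟩
    · have e0 : -1 / (a + 1) ≠ 0 := div_ne_zero (by simp) h1
      have e1 : -1 / (a + 1) + 1 ≠ 0 := by rw [hθ]; exact div_ne_zero h0 h1
      refine ⟨⟨⟨e0, e1⟩, fun h => h2 ?_⟩, ?_⟩
      · field_simp at h
        linear_combination h
      · have hd : (-1 / (a + 1)) ^ 2 + -1 / (a + 1) = -a / (a + 1) ^ 2 := by field_simp; ring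
        rw [hd, div_eq_div_iff (div_ne_zero (neg_ne_zero.2 h0) (pow_ne_zero 2 h1)) ha2]
        field_simp
        ring
    · have e0 : -(a + 1) / a ≠ 0 := div_ne_zero (neg_ne_zero.2 h1) h0
      have e1 : -(a + 1) / a + 1 ≠ 0 := by rw [hθθ]; exact div_ne_zero (by simp) h0
      refine ⟨⟨⟨e0, e1⟩, fun h => h2 ?_⟩, ?_⟩
      · field_simp at h
        linear_combination h
      · have hd : (-(a + 1) / a) ^ 2 + -(a + 1) / a = (a + 1) / a ^ 2 := by field_simp; ring
        rw [hd, div_eq_div_iff (div_ne_zero h1 (pow_ne_zero 2 h0)) ha2]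
        field_simp
        ring)
  have hT : #{t : F | t ≠ 0 ∧ t + 1 ≠ 0} + 2 ≤ Fintype.card F := by
    have hp : #({0, -1} : Finset F) = 2 := card_pair (by simp)
    rw [← hp, ← card_univ, ← card_union_of_disjoint]
    · exact card_le_card (subset_univ _)
    · rw [disjoint_left]
      intro t ht
      simp only [mem_filter, mem_univ, true_and] at ht
      simp [ht.1, ← add_eq_zero_iff_eq_neg, ht.2]
  rw [rootParameters]
  omega

/-- The excluded arguments `0` and `-1` are harmless: there the left side is `-p` or `p` and the
right side is zero. -/
theorem cubic_ne_of_notMem {p k : F} (hp : p ≠ 0) (hk : k / p ∉ rootParameters F) (t : F) :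
    p * (t ^ 3 + 3 * t ^ 2 - 1) ≠ k * (t ^ 2 + t) := by
  intro h
  by_cases h0 : t = 0
  · subst h0
    apply hp
    linear_combination -h
  by_cases h1 : t + 1 = 0
  · apply hp
    linear_combination h - (p * (t ^ 2 + 2 * t - 2) - k * t) * h1
  · apply hk
    refine mem_image.2 ⟨t, by simp [h0, h1], ?_⟩
    have ht : t ^ 2 + t ≠ 0 := by
      have : t ^ 2 + t = t * (t + 1) := by ring
      rw [this]
      exact mul_ne_zero h0 h1
    rw [div_eq_div_iff ht hp]
    linear_combination h

/-- The parameters `n` for which `t² - t + n` has no root. -/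
def nonsplitParameters (F : Type*) [Field F] [Fintype F] [DecidableEq F] : Finset F :=
  (univ.image fun t : F => t - t ^ 2)ᶜ

theorem card_le_two_mul_card_nonsplitParameters :
    Fintype.card F ≤ 2 * #(nonsplitParameters F) + 1 := by
  have h1 := two_mul_card_image_sub_sq_le (F := F)
  have h2 := card_add_card_compl (univ.image fun t : F => t - t ^ 2)
  rw [nonsplitParameters]
  omega

theorem exists_parameters_of_injOn {S : Finset F} {p k : F → F} (hS : S ⊆ nonsplitParameters F)
    (hp : ∀ n ∈ S, p n ≠ 0) (hinj : Set.InjOn (fun n => k n / p n) S)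
    (hcard : #(rootParameters F) < #S) :
    ∃ n ∈ nonsplitParameters F, ∀ t : F, p n * (t ^ 3 + 3 * t ^ 2 - 1) ≠ k n * (t ^ 2 + t) := by
  rw [← card_image_of_injOn hinj] at hcard
  obtain ⟨c, hc, hc'⟩ := exists_mem_notMem_of_card_lt_card hcard
  obtain ⟨n, hn, rfl⟩ := mem_image.1 hc
  exact ⟨n, hS hn, cubic_ne_of_notMem (hp n hn) hc'⟩

theorem exists_parameter_of_two_ne_zero (h2 : (2 : F) ≠ 0) (hcard : 7 < Fintype.card F) :
    ∃ n ∈ nonsplitParameters F, ∀ t : F,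
      2 * (t ^ 3 + 3 * t ^ 2 - 1) ≠ (2 + n) * (t ^ 2 + t) := by
  refine exists_parameters_of_injOn (p := fun _ => 2) (k := fun n => 2 + n) subset_rfl
    (fun _ _ => h2) ?_ ?_
  · intro a _ b _ hab
    have hab' : (2 + a) / 2 = (2 + b) / 2 := hab
    rw [div_left_inj' h2] at hab'
    exact add_left_cancel hab'
  · have := three_mul_card_rootParameters_le (F := F)
    have := card_roots_le_two (F := F)
    have := card_le_two_mul_card_nonsplitParameters (F := F)
    omega

theorem exists_parameter_of_card_prime {q : ℕ} (hq : q.Prime) (hcard : Fintype.card F = q)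
    (h : ∃ n : ZMod q, (∀ t : ZMod q, t - t ^ 2 ≠ n) ∧
      ∀ t : ZMod q, 2 * (t ^ 3 + 3 * t ^ 2 - 1) ≠ (2 + n) * (t ^ 2 + t)) :
    ∃ n ∈ nonsplitParameters F, ∀ t : F,
      2 * (t ^ 3 + 3 * t ^ 2 - 1) ≠ (2 + n) * (t ^ 2 + t) := by
  obtain ⟨n, h1, h2⟩ := h
  obtain ⟨e⟩ : Nonempty (ZMod q ≃+* F) := ⟨ZMod.ringEquivOfPrime F hq hcard⟩
  refine ⟨e n, ?_, fun t ht => h2 (e.symm t) (e.injective ?_)⟩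
  · simp only [nonsplitParameters, mem_compl, mem_image, mem_univ, true_and, not_exists]
    intro t ht
    exact h1 (e.symm t) (e.injective (by simp [ht]))
  · simpa [map_ofNat] using ht

theorem exists_parameters_of_two_eq_zero (h2 : (2 : F) = 0) (hcard : 4 < Fintype.card F) :
    ∃ y : F, y ≠ 0 ∧ y + 1 ≠ 0 ∧ ∃ n ∈ nonsplitParameters F, ∀ t : F,
      (2 * y + (1 - n) * (y ^ 2 - y)) * (t ^ 3 + 3 * t ^ 2 - 1) ≠
      (3 * y + 3 * y ^ 2 - 3 + (1 - n) * (y ^ 3 + 1 - 3 * y)) * (t ^ 2 + t) := by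
  -- Roots of `t ^ 2 + t + 1` are avoided because that factor appears in the injectivity determinant
  -- `h3`; at most four elements are excluded in all.
  obtain ⟨y, -, hy⟩ : ∃ y ∈ (univ : Finset F),
      y ∉ {0, 1} ∪ ({t : F | t ^ 2 + t + 1 = 0} : Finset F) := by
    apply exists_mem_notMem_of_card_lt_card
    have h1 := card_union_le {0, 1} ({t : F | t ^ 2 + t + 1 = 0} : Finset F)
    have h3 := card_roots_le_two (F := F)
    have h4 : #({0, 1} : Finset F) ≤ 2 := card_le_two
    rw [card_univ]
    omega
  simp only [mem_union, mem_insert, mem_singleton, mem_filter, mem_univ, true_and, not_or] at hy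
  obtain ⟨⟨hy0, hy1⟩, hy2⟩ := hy
  have hyd : y ^ 2 - y ≠ 0 := by
    have : y ^ 2 - y = y * (y - 1) := by ring
    rw [this]
    exact mul_ne_zero hy0 (sub_ne_zero.2 hy1)
  have hne {n : F} (hn : n ∈ (nonsplitParameters F).erase 1) : 1 - n ≠ 0 :=
    sub_ne_zero.2 (ne_of_mem_erase hn).symm
  have hp {n : F} (hn : n ∈ (nonsplitParameters F).erase 1) :
      2 * y + (1 - n) * (y ^ 2 - y) ≠ 0 := by
    rw [h2, zero_mul, zero_add]
    exact mul_ne_zero (hne hn) hyd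
  refine ⟨y, hy0, fun h => hy1 (by linear_combination h - h2), ?_⟩
  refine exists_parameters_of_injOn (p := fun n => 2 * y + (1 - n) * (y ^ 2 - y))
    (k := fun n => 3 * y + 3 * y ^ 2 - 3 + (1 - n) * (y ^ 3 + 1 - 3 * y))
    (erase_subset 1 _) (fun n hn => hp hn) ?_ ?_
  · intro a ha b hb hab
    have hab' := (div_eq_div_iff (hp ha) (hp hb)).1 hab
    have h3 : (y ^ 2 - y) * (y ^ 2 + y + 1) * (a - b) = 0 := by
      linear_combination hab' - h2 * (a - b) *
        ((y ^ 2 - y) * (y ^ 2 + y - 2) - y * (y ^ 3 + 1 - 3 * y))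
    rcases mul_eq_zero.1 h3 with h | h
    · exact absurd h (mul_ne_zero hyd hy2)
    · exact sub_eq_zero.1 h
  · have h1 := three_mul_card_rootParameters_le (F := F)
    have h3 := card_roots_le_two (F := F)
    have h4 := card_le_two_mul_card_nonsplitParameters (F := F)
    -- The value `n = 1` makes the leading coefficient zero in characteristic two. Dropping it is
    -- affordable if `t ^ 2 + t + 1` has no root; if it has one, `1` is not a nonsplit parameter and
    -- nothing is lost.
    have h5 := pred_card_le_card_erase (s := nonsplitParameters F) (a := 1)
    have heven : Fintype.card F % 2 = 0 := by
      rw [← FiniteField.even_card_iff_char_two]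
      exact CharP.ringChar_of_prime_eq_zero Nat.prime_two (by exact_mod_cast h2)
    rcases ({t : F | t ^ 2 + t + 1 = 0} : Finset F).eq_empty_or_nonempty with h | ⟨a, ha⟩
    · rw [h, card_empty] at h1
      omega
    · have hmem : (1 : F) ∉ nonsplitParameters F := by
        simp only [nonsplitParameters, mem_compl, mem_image, mem_univ, true_and, not_not]
        simp only [mem_filter, mem_univ, true_and] at ha
        exact ⟨a, by linear_combination (a + 1 - 1) * h2 - ha⟩
      rw [erase_eq_of_notMem hmem]
      omega

theorem exists_parameters (hq2 : Fintype.card F ≠ 2) (hq4 : Fintype.card F ≠ 4) :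
    ∃ y : F, y ≠ 0 ∧ y + 1 ≠ 0 ∧ ∃ n ∈ nonsplitParameters F, ∀ t : F,
      (2 * y + (1 - n) * (y ^ 2 - y)) * (t ^ 3 + 3 * t ^ 2 - 1) ≠
      (3 * y + 3 * y ^ 2 - 3 + (1 - n) * (y ^ 3 + 1 - 3 * y)) * (t ^ 2 + t) := by
  have hq1 := Fintype.one_lt_card (α := F)
  by_cases h2 : (2 : F) = 0
  · refine exists_parameters_of_two_eq_zero h2 ?_
    have : Fintype.card F % 2 = 0 := by
      rw [← FiniteField.even_card_iff_char_two]
      exact CharP.ringChar_of_prime_eq_zero Nat.prime_two (by exact_mod_cast h2)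
    omega
  · obtain ⟨n, hn, h⟩ : ∃ n ∈ nonsplitParameters F, ∀ t : F,
        2 * (t ^ 3 + 3 * t ^ 2 - 1) ≠ (2 + n) * (t ^ 2 + t) := by
      have hodd : Fintype.card F % 2 = 1 := by
        apply FiniteField.odd_card_of_char_ne_two
        intro h
        apply h2
        have := ringChar.Nat.cast_ringChar (R := F)
        rw [h] at this
        exact_mod_cast this
      rcases le_or_gt (Fintype.card F) 7 with h7 | h7
      · obtain h3 | h5 | h7 : Fintype.card F = 3 ∨ Fintype.card F = 5 ∨ Fintype.card F = 7 := by
          omega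
        · exact exists_parameter_of_card_prime Nat.prime_three h3 (by decide)
        · exact exists_parameter_of_card_prime Nat.prime_five h5 (by decide)
        · exact exists_parameter_of_card_prime (by norm_num) h7 (by decide)
      · exact exists_parameter_of_two_ne_zero h2 h7
    -- At `y = 1` the two coefficients become `2` and `2 + n`.
    refine ⟨1, one_ne_zero, by rwa [one_add_one_eq_two], n, hn, fun t ht => h t ?_⟩
    linear_combination ht

end Counting

/-! ### Realising the parameter `n` inside `E` -/

section Existence

open Polynomial

theorem exists_root_of_mem_nonsplitParameters {F E : Type*} [Field F] [Fintype F] [DecidableEq F]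
    [Field E] [Algebra F E] (hFE : Module.finrank F E = 2) {n : F}
    (hn : n ∈ nonsplitParameters F) :
    ∃ ξ : E, ξ ∉ Set.range (algebraMap F E) ∧ ξ ^ 2 = ξ - algebraMap F E n := by
  have := Module.finite_of_finrank_pos (hFE ▸ two_pos : 0 < Module.finrank F E)
  have : Finite E := Module.finite_of_finite F
  simp only [nonsplitParameters, Finset.mem_compl, Finset.mem_image, Finset.mem_univ, true_and,
    not_exists] at hn
  have hdeg : (X ^ 2 - X + C n : F[X]).natDegree = 2 := by compute_degree!
  have hmonic : (X ^ 2 - X + C n : F[X]).Monic := by monicity!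
  have hirr : Irreducible (X ^ 2 - X + C n : F[X]) := by
    refine irreducible_of_degree_le_three_of_not_isRoot (by simp [hdeg]) fun t ht => hn t ?_
    simp only [IsRoot.def, eval_add, eval_sub, eval_pow, eval_X, eval_C] at ht
    linear_combination -ht
  have := Fact.mk hirr
  have hfin : Module.finrank F (AdjoinRoot (X ^ 2 - X + C n : F[X])) = 2 := by
    rw [(AdjoinRoot.powerBasis hirr.ne_zero).finrank, AdjoinRoot.powerBasis_dim, hdeg]
  obtain ⟨φ⟩ := FiniteField.nonempty_algHom_of_finrank_dvd
    (F := F) (K := AdjoinRoot (X ^ 2 - X + C n : F[X])) (L := E) (by rw [hfin, hFE])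
  have hroot : aeval (φ (AdjoinRoot.root _)) (X ^ 2 - X + C n : F[X]) = 0 := by
    rw [aeval_algHom_apply, AdjoinRoot.aeval_eq, AdjoinRoot.mk_self, map_zero]
  simp only [map_add, map_sub, map_pow, aeval_X, aeval_C] at hroot
  refine ⟨φ (AdjoinRoot.root _), ?_, by linear_combination hroot⟩
  rintro ⟨t, ht⟩
  rw [← ht] at hroot
  apply hn t
  apply (algebraMap F E).injective
  rw [map_sub, map_pow]
  linear_combination -hroot

end Existence

end HiggledyPiggledy

theorem mainTheorem6 {F E : Type*} [Field F] [Finite F] [Field E] [Algebra F E]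
    (hFE : Module.finrank F E = 2) :
    HiggledyPiggledy.IsLineSpread (HiggledyPiggledy.desarguesianSpread F E) ∧
    (∀ (x : F) (ξ : E), HiggledyPiggledy.IsAdmissible x ξ →
      (HiggledyPiggledy.fieldReduction F '' HiggledyPiggledy.pointSet x ξ).ncard = 7 ∧
      HiggledyPiggledy.fieldReduction F '' HiggledyPiggledy.pointSet x ξ ⊆
        HiggledyPiggledy.desarguesianSpread F E ∧
      HiggledyPiggledy.IsHiggledyPiggledy
        (HiggledyPiggledy.fieldReduction F '' HiggledyPiggledy.pointSet x ξ)) ∧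
    (Nat.card F ≠ 2 → Nat.card F ≠ 4 →
      ∃ (x : F) (ξ : E), HiggledyPiggledy.IsAdmissible x ξ) := by
  refine ⟨HiggledyPiggledy.isLineSpread_desarguesianSpread hFE, ?_, ?_⟩
  · rintro x ξ ⟨-, -, hξ, hcard, hcurve⟩
    refine ⟨?_, Set.image_subset_range _ _, ?_, ?_⟩
    · rw [Set.ncard_image_of_injective _ HiggledyPiggledy.fieldReduction_injective, hcard]
    · rintro _ ⟨P, -, rfl⟩
      exact HiggledyPiggledy.isLine_fieldReduction hFE P
    · exact HiggledyPiggledy.isCuttingBlockingSet_of_not_subset_curve hFE hξ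
        (HiggledyPiggledy.pointSet_frame x ξ) hcurve
  · intro h2 h4
    classical
    have := Fintype.ofFinite F
    rw [Nat.card_eq_fintype_card] at h2 h4
    obtain ⟨y, hy0, hy1, n, hn, hG⟩ := HiggledyPiggledy.exists_parameters h2 h4
    obtain ⟨ξ, hξ, hξn⟩ :=
      HiggledyPiggledy.exists_root_of_mem_nonsplitParameters (E := E) hFE hn
    exact ⟨-y, ξ, HiggledyPiggledy.isAdmissible_neg hFE hξ hξn hy0 hy1 hG⟩
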